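/- **Theorem 3.1 (non-orthogonality of the spectral polynomials).** Let $\alpha_1<\alpha_2<\alpha_3$ be real numbers, let $\rho_1,\rho_2,\rho_3>0$, and put $$A(x)=\prod_{j=1}^3(x-\alpha_j),\qquad B(x)=\sum_{j=1}^3 2\rho_j\prod_{i\ne j}(x-\alpha_i).$$ A real number $\nu$ is called a Van Vleck zero of order $k$ if, for some constant $\mu\in\mathbb R$, the Lamé equation $$A(x)\,\varphi''(x)+B(x)\,\varphi'(x)=\mu\,(x-\nu)\,\varphi(x)$$ has a polynomial solution $\varphi$ with real coefficients of degree exactly $k$. For $k\ge 1$ there are exactly $k+1$ of them, $\nu_1^{(k)}<\dots<\nu_{k+1}^{(k)}$ (a classical fact), and the spectral polynomials are $$p_{k+1}(x)=\prod_{i=1}^{k+1}\bigl(x-\nu_i^{(k)}\bigr)\quad(k\ge 1),\qquad p_0=1,\qquad p_1(x)=x-\nu_0,$$ where $\nu_0\in\mathbb R$ is arbitrary (every real number is a Van Vleck zero of order $0$). Then, for every choice of $\nu_0$, the sequence $(p_n)_{n\ge 0}$ is not orthogonal with respect to any measure: there is no positive Borel measure $m$ on $\mathbb R$ such that all products $p_ip_j$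 are $m$-integrable, $\int p_ip_j\,dm=0$ for all $i\ne j$, and $\int p_i^2\,dm\neq 0$ for all $i$. -/

import Mathlib

open Polynomial MeasureTheory

noncomputable section

namespace Lame

/-- The leading coefficient `A(x) = ∏ⱼ (x - αⱼ)` of the Lamé equation. -/
def coeffA (α : Fin 3 → ℝ) : ℝ[X] :=
  ∏ j, (X - C (α j))

/-- The coefficient `B(x) = ∑ⱼ 2 ρⱼ ∏_{i ≠ j} (x - αᵢ)` of the Lamé equation. -/
def coeffB (α ρ : Fin 3 → ℝ) : ℝ[X] :=
  ∑ j, C (2 * ρ j) * ∏ i ∈ Finset.univ.erase j, (X - C (α i))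

/-- The Van Vleck zeros of order `k`: all `ν` for which the Lamé equation
`A φ'' + B φ' = μ (x - ν) φ` has, for some constant `μ`, a polynomial solution `φ`
of degree exactly `k`. -/
def vanVleckZeros (α ρ : Fin 3 → ℝ) (k : ℕ) : Set ℝ :=
  {ν | ∃ (μ : ℝ) (φ : ℝ[X]), φ.degree = (k : WithBot ℕ) ∧
    coeffA α * derivative (derivative φ) + coeffB α ρ * derivative φ =
      C μ * (X - C ν) * φ}

/-- The spectral polynomials `pₖ`: `p₀ = 1` is the empty product, and
`p_{k+1}(x) = ∏ (x - ν)` over the Van Vleck zeros `ν` of order `k`, for every `k ≥ 1`.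
Order `0` is degenerate: every real number is a Van Vleck zero of order `0`, so the
single zero `ν₀` of `p₁` is kept as a free parameter. -/
def spectralPoly (α ρ : Fin 3 → ℝ) (ν₀ : ℝ) : ℕ → ℝ[X]
  | 0 => 1
  | 1 => X - C ν₀
  | k + 2 => ∏ᶠ ν ∈ vanVleckZeros α ρ (k + 1), (X - C ν)

/-- The sequence of polynomials `p₀, p₁, p₂, …` is orthogonal with respect to the positive
Borel measure `m` on the real line: all products are integrable, distinct members are
orthogonal, and no member has norm zero. -/
def IsOrthogonalSeq (p : ℕ → ℝ[X]) (m : Measure ℝ) : Prop :=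
  (∀ i j, Integrable (fun x => (p i).eval x * (p j).eval x) m) ∧
  (∀ i j, i ≠ j → ∫ x, (p i).eval x * (p j).eval x ∂m = 0) ∧
  (∀ i, ∫ x, (p i).eval x * (p i).eval x ∂m ≠ 0)

end Lame

end

/-!
The Van Vleck zeros of order `k ≥ 1` are the eigenvalues of a tridiagonal matrix, and the
asymptotics of these matrices contradict a three-term recurrence.

In a coordinate centred at the middle root `α 1`, the leading coefficient of the equation is
`X³ - s X² - c X` with `c > 0`, and the equation is a three-term recurrence for the coefficients of
`φ` (`isLameSolution_iff`). Degree exactly `k` forces `μ = k (k - 1 + τ)` with `τ = 2 ∑ ρⱼ`, and a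
solution exists if and only if the shifted `ν` is a root of the characteristic polynomial
`lameContinuant k (k + 1)` of a tridiagonal matrix with diagonal `d_{k,i}` and off-diagonal products
`o_{k,i} > 0` (`exists_isLameSolution_iff`). Positivity makes the roots real and simple, so this
polynomial is the shifted `p_{k+1}` (`spectralPoly_add_two`).

If the monic sequence `p` were orthogonal, it would satisfy a three-term recurrence with
coefficients `a`, `b` (`IsOrthogonalSeq.exists_eq_continuant`). The sums of the first, second and
fourth powers of the roots of a polynomial given by a three-term recurrence are sums of local
expressions in the recurrence coefficients (`powerSumOne_continuant`, `powerSumTwo_continuant`,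
`powerSumFour_continuant`), and each can be computed in two ways: from `a`, `b`, and from
`d_{k,i}`, `o_{k,i}`. With `t = i / k`, the latter are close to `s t²` and `c t² (1 - t²)`.
The increments in `k` of the first two sums give the limits of the recurrence coefficients,
`a → s / 3` and `b → (2 s² + 6 c) / 45`, hence the mean fourth power of the roots tends to
`a⁴ + 12 a² b + 6 b²` evaluated there. The tridiagonal matrices give instead the integral over
`[0, 1]` of `s⁴ t⁸ + 12 s² c t⁶ (1 - t²) + 6 c² t⁴ (1 - t²)²`. Each of the coefficients of
`s⁴`, `s² c` and `c²` is strictly larger in the second expression, which is a contradiction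
(`not_forall_continuant_eq_lameContinuant`).
-/

open Polynomial MeasureTheory

noncomputable section

namespace Lame

/-! ### Continuants: polynomials given by a three-term recurrence -/

/-- The monic polynomials with `q₀ = 1`, `q₁ = X - a₀` and
`q_{n+2} = (X - a_{n+1}) q_{n+1} - b_{n+1} q_n`: the characteristic polynomials of the leading
blocks of the tridiagonal matrix with diagonal `a` and off-diagonal products `b`.
The value `b 0` is not used. -/
def continuant (a b : ℕ → ℝ) : ℕ → ℝ[X]
  | 0 => 1
  | 1 => X - C (a 0)
  | n + 2 => (X - C (a (n + 1))) * continuant a b (n + 1) - C (b (n + 1)) * continuant a b n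

section Continuant

variable (a b : ℕ → ℝ)

@[simp] lemma continuant_zero : continuant a b 0 = 1 := rfl

@[simp] lemma continuant_one : continuant a b 1 = X - C (a 0) := rfl

lemma continuant_add_two (n : ℕ) : continuant a b (n + 2) =
    (X - C (a (n + 1))) * continuant a b (n + 1) - C (b (n + 1)) * continuant a b n := rfl

lemma continuant_monic_natDegree (n : ℕ) :
    (continuant a b n).Monic ∧ (continuant a b n).natDegree = n := by
  induction n using Nat.strong_induction_on with
  | _ n ih =>
    match n with
    | 0 => simp
    | 1 => simp [monic_X_sub_C]
    | n + 2 =>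
      obtain ⟨h1, d1⟩ := ih (n + 1) (by omega)
      obtain ⟨h0, d0⟩ := ih n (by omega)
      have hm : ((X - C (a (n + 1))) * continuant a b (n + 1)).Monic :=
        (monic_X_sub_C _).mul h1
      have hd : ((X - C (a (n + 1))) * continuant a b (n + 1)).natDegree = n + 2 := by
        rw [(monic_X_sub_C _).natDegree_mul h1, natDegree_X_sub_C, d1]; ring
      have hlt : (C (b (n + 1)) * continuant a b n).natDegree <
          ((X - C (a (n + 1))) * continuant a b (n + 1)).natDegree := by
        have := natDegree_C_mul_le (b (n + 1)) (continuant a b n)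
        omega
      rw [continuant_add_two]
      refine ⟨hm.sub_of_left (degree_lt_degree hlt), ?_⟩
      rw [natDegree_sub_eq_left_of_natDegree_lt hlt, hd]

lemma continuant_monic (n : ℕ) : (continuant a b n).Monic :=
  (continuant_monic_natDegree a b n).1

lemma natDegree_continuant (n : ℕ) : (continuant a b n).natDegree = n :=
  (continuant_monic_natDegree a b n).2

variable {a b}

/-- The Wronskian of consecutive continuants is positive on the real line, because it satisfies
`W_{n+1} = q_{n+1}² + b_{n+1} W_n`. -/
lemma continuant_wronskian_pos {n : ℕ} (hb : ∀ i, 1 ≤ i → i ≤ n → 0 < b i) (x : ℝ) :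
    0 < (derivative (continuant a b (n + 1))).eval x * (continuant a b n).eval x -
      (derivative (continuant a b n)).eval x * (continuant a b (n + 1)).eval x := by
  induction n with
  | zero => simp
  | succ n ih =>
    have h := ih fun i h1 h2 => hb i h1 (by omega)
    have hpos := mul_pos (hb (n + 1) (by omega) le_rfl) h
    rw [continuant_add_two]
    simp only [derivative_sub, derivative_mul, derivative_X, derivative_C, eval_sub, eval_mul,
      eval_add, eval_X, eval_C, eval_one, eval_zero]
    nlinarith [sq_nonneg ((continuant a b (n + 1)).eval x)]

/-- With positive `b`, all complex roots of a continuant are real: off the real line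
`Im (q_{n+1} q̄_n)` has the sign of `Im z`. -/
lemma im_continuant_mul_conj_pos {n : ℕ} (hb : ∀ i, 1 ≤ i → i ≤ n → 0 < b i) {z : ℂ}
    (hz : z.im ≠ 0) :
    0 < z.im * (aeval z (continuant a b (n + 1)) *
      (starRingEnd ℂ) (aeval z (continuant a b n))).im := by
  induction n with
  | zero => simpa using mul_self_pos.2 hz
  | succ n ih =>
    have h := ih fun i h1 h2 => hb i h1 (by omega)
    have hpos := mul_pos (hb (n + 1) (by omega) le_rfl) h
    rw [continuant_add_two]
    simp only [map_sub, map_mul, aeval_X, aeval_C, Complex.coe_algebraMap]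
    simp only [Complex.mul_im, Complex.mul_re, Complex.sub_im, Complex.sub_re, Complex.ofReal_re,
      Complex.ofReal_im, Complex.conj_re, Complex.conj_im] at hpos ⊢
    set p := aeval z (continuant a b (n + 1))
    nlinarith [mul_nonneg (mul_self_nonneg z.im) (add_nonneg (mul_self_nonneg p.re)
      (mul_self_nonneg p.im))]

lemma continuant_splits {n : ℕ} (hb : ∀ i, 1 ≤ i → i ≤ n → 0 < b i) :
    (continuant a b (n + 1)).Splits := by
  refine Splits.of_splits_map (algebraMap ℝ ℂ) (IsAlgClosed.splits _) fun z hz => ?_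
  have h0 : aeval z (continuant a b (n + 1)) = 0 := by
    rw [← eval_map_algebraMap]
    exact (mem_roots'.1 hz).2
  by_cases him : z.im = 0
  · exact ⟨z.re, Complex.ext (by simp) (by simp [him])⟩
  · have := im_continuant_mul_conj_pos (a := a) hb him
    simp [h0] at this

lemma continuant_roots_nodup {n : ℕ} (hb : ∀ i, 1 ≤ i → i ≤ n → 0 < b i) :
    (continuant a b (n + 1)).roots.Nodup := by
  refine nodup_roots (Polynomial.separable_def _ |>.2 ?_)
  refine isCoprime_of_irreducible_dvd ?_ ?_
  · exact fun h => (continuant_monic a b (n + 1)).ne_zero h.1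
  · intro p hp h1 h2
    obtain ⟨x, hx⟩ := ((continuant_splits hb).of_dvd (continuant_monic a b _).ne_zero
      h1).exists_eval_eq_zero (degree_pos_of_irreducible hp).ne'
    have := continuant_wronskian_pos (a := a) hb x
    rw [eval_eq_zero_of_dvd_of_eval_eq_zero h1 hx,
      eval_eq_zero_of_dvd_of_eval_eq_zero h2 hx] at this
    simp at this

/-- With positive `b`, a shifted continuant is the product over its set of real roots. -/
lemma finprod_roots_continuant {n : ℕ} (hb : ∀ i, 1 ≤ i → i ≤ n → 0 < b i) (r : ℝ) :
    ∏ᶠ ν ∈ {ν : ℝ | (continuant a b (n + 1)).eval (ν - r) = 0}, (X - C ν) =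
      (continuant a b (n + 1)).comp (X - C r) := by
  set q := continuant a b (n + 1)
  have hq : q.Monic := continuant_monic a b (n + 1)
  have hs : q.Splits := continuant_splits hb
  have hset : {ν : ℝ | q.eval (ν - r) = 0} =
      ↑((q.roots.map (· + r)).toFinset) := by
    ext ν
    simp only [Set.mem_ofPred_eq, Finset.mem_coe, Multiset.mem_toFinset, Multiset.mem_map,
      mem_roots hq.ne_zero,
      IsRoot.def]
    exact ⟨fun h => ⟨ν - r, h, by ring⟩, by rintro ⟨x, h, rfl⟩; simpa using h⟩
  rw [hset, finprod_mem_coe_finset, Finset.prod_eq_multiset_prod, Multiset.toFinset_val,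
    Multiset.dedup_eq_self.2 ((continuant_roots_nodup hb).map (add_left_injective r)),
    Multiset.map_map]
  conv_rhs => rw [hs.eq_prod_roots_of_monic hq, multiset_prod_comp,
    Multiset.map_map]
  congr 1
  refine Multiset.map_congr rfl fun x _ => ?_
  simp only [Function.comp, map_add, sub_comp, X_comp, C_comp]
  ring

end Continuant

/-! ### Orthogonality forces a three-term recurrence -/

section Favard

variable {p : ℕ → ℝ[X]}

lemma mem_span_of_degree_lt (hm : ∀ n, (p n).Monic) (hd : ∀ n, (p n).natDegree = n)
    (n : ℕ) (q : ℝ[X]) (hq : q.degree < n) : q ∈ Submodule.span ℝ (p '' Set.Iio n) := by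
  induction n generalizing q with
  | zero =>
    have : q = 0 := by simpa [Nat.WithBot.lt_zero_iff] using hq
    simp [this]
  | succ n ih =>
    have hpn : p n ∈ Submodule.span ℝ (p '' Set.Iio (n + 1)) :=
      Submodule.subset_span ⟨n, by simp, rfl⟩
    have hc : (p n).coeff n = 1 := by simpa [hd n] using (hm n).coeff_natDegree
    have h : (q - q.coeff n • p n).degree < n := by
      rw [degree_lt_iff_coeff_zero] at hq ⊢
      intro m hnm
      rcases hnm.eq_or_lt with rfl | h
      · simp [hc]
      · simp [hq m h, coeff_eq_zero_of_natDegree_lt (p := p n) (n := m) (by rw [hd]; exact h)]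
    have h2 := Submodule.span_mono (R := ℝ)
      (Set.image_mono (f := p) (Set.Iio_subset_Iio n.le_succ)) (ih _ h)
    simpa using Submodule.add_mem _ h2 (Submodule.smul_mem _ (q.coeff n) hpn)

/-- A monic sequence that is orthogonal for a linear functional on polynomials satisfies a
three-term recurrence. -/
lemma exists_eq_continuant_of_orthogonal (hm : ∀ n, (p n).Monic) (hd : ∀ n, (p n).natDegree = n)
    (L : ℝ[X] →ₗ[ℝ] ℝ) (ho : ∀ i j, i ≠ j → L (p i * p j) = 0) (hn : ∀ i, L (p i * p i) ≠ 0) :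
    ∃ a b : ℕ → ℝ, b 0 = 0 ∧ ∀ n, p n = continuant a b n := by
  have hc : ∀ n, (p n).coeff n = 1 := fun n => by simpa [hd n] using (hm n).coeff_natDegree
  have hlow : ∀ (n : ℕ) (q : ℝ[X]), q.degree < n → L (p n * q) = 0 := by
    intro n q hq
    refine Submodule.span_induction (p := fun q _ => L (p n * q) = 0) ?_ (by simp) ?_ ?_
      (mem_span_of_degree_lt hm hd n q hq)
    · rintro _ ⟨i, hi, rfl⟩
      exact ho n i (ne_of_gt hi)
    · intro x y _ _ hx hy
      rw [mul_add, map_add, hx, hy, add_zero]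
    · intro c x _ hx
      rw [mul_smul_comm, map_smul, hx, smul_zero]
  have hp0 : p 0 = 1 := eq_one_of_monic_natDegree_zero (hm 0) (hd 0)
  have key : ∀ n, ∃ a b : ℝ, p (n + 2) = (X - C a) * p (n + 1) - C b * p n := by
    intro n
    -- `a` and `b` are chosen to cancel the coefficients of degrees `n + 1` and `n`.
    obtain ⟨a, ha⟩ : ∃ a, a = (X * p (n + 1) - p (n + 2)).coeff (n + 1) := ⟨_, rfl⟩
    obtain ⟨b, hb⟩ : ∃ b, b = (X * p (n + 1) - p (n + 2) - C a * p (n + 1)).coeff n := ⟨_, rfl⟩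
    refine ⟨a, b, ?_⟩
    obtain ⟨r, hr⟩ : ∃ r, r = X * p (n + 1) - p (n + 2) - C a * p (n + 1) - C b * p n := ⟨_, rfl⟩
    have hrd : r.degree < n := by
      rw [degree_lt_iff_coeff_zero]
      intro m hnm
      rcases hnm.eq_or_lt with rfl | h
      · rw [hr, coeff_sub, ← hb, coeff_C_mul, hc, mul_one, sub_self]
      have h0 : (p n).coeff m = 0 := coeff_eq_zero_of_natDegree_lt (by rw [hd]; exact h)
      rcases (show n + 1 ≤ m from h).eq_or_lt with rfl | h
      · rw [hr, coeff_sub, coeff_sub, ← ha, coeff_C_mul, coeff_C_mul, hc, h0]; ring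
      have h1 : (p (n + 1)).coeff m = 0 := coeff_eq_zero_of_natDegree_lt (by rw [hd]; exact h)
      obtain ⟨m, rfl⟩ : ∃ k, m = k + 1 := ⟨m - 1, by omega⟩
      rw [hr, coeff_sub, coeff_sub, coeff_sub, coeff_C_mul, coeff_C_mul, h0, h1, coeff_X_mul]
      rcases (show n + 1 ≤ m by omega).eq_or_lt with rfl | h
      · rw [hc, hc]; ring
      · rw [coeff_eq_zero_of_natDegree_lt (by rw [hd]; exact h),
          coeff_eq_zero_of_natDegree_lt (by rw [hd]; omega)]; ring
    by_cases h0 : r = 0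
    · rw [h0] at hr
      linear_combination hr
    exfalso
    set d := r.natDegree
    have hdn : d < n := by rwa [degree_eq_natDegree h0, Nat.cast_lt] at hrd
    have hdeg : (p d).degree = d := by rw [degree_eq_natDegree (hm d).ne_zero, hd]
    have hlt : ∀ m, d < m → (p d).degree < m := fun m h => by
      rw [hdeg]; exact_mod_cast h
    have e1 : L (r * p d) = 0 := by
      have h1 := hlow (n + 1) (X * p d) (by
        rw [degree_mul, degree_X, hdeg]; exact_mod_cast (by omega : 1 + d < n + 1))
      have h2 := hlow (n + 2) _ (hlt (n + 2) (by omega))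
      have h3 := hlow (n + 1) _ (hlt (n + 1) (by omega))
      have h4 := hlow n _ (hlt n hdn)
      have : r * p d = p (n + 1) * (X * p d) - p (n + 2) * p d - a • (p (n + 1) * p d) -
          b • (p n * p d) := by
        rw [hr, smul_eq_C_mul, smul_eq_C_mul]; ring
      rw [this]
      simp [h1, h2, h3, h4]
    have hlead : r.leadingCoeff ≠ 0 := leadingCoeff_ne_zero.2 h0
    have hlow' : (r - r.leadingCoeff • p d).degree < d := by
      rw [degree_lt_iff_coeff_zero]
      intro m hdm
      rcases hdm.eq_or_lt with rfl | h
      · simp [hc, d]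
      · simp [coeff_eq_zero_of_natDegree_lt h,
          coeff_eq_zero_of_natDegree_lt (p := p d) (n := m) (by rw [hd]; exact h)]
    have e2 := hlow d _ hlow'
    rw [mul_sub, map_sub, mul_comm, e1, mul_smul_comm, map_smul, zero_sub, neg_eq_zero,
      smul_eq_mul] at e2
    exact mul_ne_zero hlead (hn d) e2
  choose a b hab using key
  refine ⟨fun n => n.casesOn (-(p 1).coeff 0) a, fun n => n.casesOn 0 b, rfl, fun n => ?_⟩
  induction n using Nat.strong_induction_on with
  | _ n ih =>
    match n with
    | 0 => exact hp0
    | 1 =>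
      rw [continuant_one, eq_X_add_C_of_natDegree_le_one (hd 1).le, hc 1]
      simp
    | n + 2 =>
      rw [continuant_add_two, ← ih (n + 1) (by omega), ← ih n (by omega)]
      exact hab n

lemma IsOrthogonalSeq.exists_eq_continuant {m : Measure ℝ} (h : IsOrthogonalSeq p m)
    (hm : ∀ n, (p n).Monic) (hd : ∀ n, (p n).natDegree = n) :
    ∃ a b : ℕ → ℝ, b 0 = 0 ∧ ∀ n, p n = continuant a b n := by
  obtain ⟨hi, ho, hn⟩ := h
  have hint : ∀ q : ℝ[X], Integrable (fun x => q.eval x) m := by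
    intro q
    refine Submodule.span_induction (p := fun q _ => Integrable (fun x => q.eval x) m) ?_
      (by simp) ?_ ?_ (mem_span_of_degree_lt hm hd (q.natDegree + 1) q ?_)
    · rintro _ ⟨i, -, rfl⟩
      simpa [eq_one_of_monic_natDegree_zero (hm 0) (hd 0)] using hi i 0
    · intro x y _ _ hx hy
      simp only [eval_add]
      exact hx.add hy
    · intro c x _ hx
      simpa using hx.const_mul c
    · exact lt_of_le_of_lt degree_le_natDegree (by exact_mod_cast Nat.lt_succ_self _)
  let L : ℝ[X] →ₗ[ℝ] ℝ :=
    { toFun := fun q => ∫ x, q.eval x ∂m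
      map_add' := fun q r => by
        simp only [eval_add]
        exact integral_add (hint q) (hint r)
      map_smul' := fun c q => by
        simp only [eval_smul, smul_eq_mul, RingHom.id_apply]
        exact integral_const_mul c _ }
  refine exists_eq_continuant_of_orthogonal hm hd L (fun i j hij => ?_) (fun i => ?_)
  · simpa [L] using ho i j hij
  · simpa [L] using hn i

end Favard

/-! ### Power sums of the roots of a continuant -/

/-- The sum of the first powers of the roots of a monic polynomial of degree `n`, expressed
by Newton's identities through the coefficients of the reversed polynomial. -/
def powerSumOne (n : ℕ) (f : ℝ[X]) : ℝ := -(reflect n f).coeff 1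

/-- The sum of the squares of the roots of a monic polynomial of degree `n`, expressed
by Newton's identities through the coefficients of the reversed polynomial. -/
def powerSumTwo (n : ℕ) (f : ℝ[X]) : ℝ := (reflect n f).coeff 1 ^ 2 - 2 * (reflect n f).coeff 2

/-- The sum of the fourth powers of the roots of a monic polynomial of degree `n`, expressed
by Newton's identities through the coefficients of the reversed polynomial. -/
def powerSumFour (n : ℕ) (f : ℝ[X]) : ℝ :=
  (reflect n f).coeff 1 ^ 4 - 4 * (reflect n f).coeff 1 ^ 2 * (reflect n f).coeff 2 +
    2 * (reflect n f).coeff 2 ^ 2 + 4 * (reflect n f).coeff 1 * (reflect n f).coeff 3 -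
    4 * (reflect n f).coeff 4

section PowerSum

variable (a b : ℕ → ℝ)

lemma reflect_continuant_one : reflect 1 (continuant a b 1) = 1 - C (a 0) * X := by
  simp [reflect_sub, reflect_C]

lemma reflect_continuant_add_two (n : ℕ) :
    reflect (n + 2) (continuant a b (n + 2)) =
      reflect (n + 1) (continuant a b (n + 1)) -
        C (a (n + 1)) * (X * reflect (n + 1) (continuant a b (n + 1))) -
        C (b (n + 1)) * (X * (X * reflect n (continuant a b n))) := by
  have h1 : reflect (n + 2) ((X - C (a (n + 1))) * continuant a b (n + 1)) =
      (1 - C (a (n + 1)) * X) * reflect (n + 1) (continuant a b (n + 1)) := by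
    rw [show n + 2 = 1 + (n + 1) by ring, reflect_mul _ _ (natDegree_X_sub_C_le _)
      (natDegree_continuant a b (n + 1)).le]
    simp [reflect_sub, reflect_C]
  have h2 : reflect (n + 2) (C (b (n + 1)) * continuant a b n) =
      C (b (n + 1)) * X ^ 2 * reflect n (continuant a b n) := by
    rw [show n + 2 = 2 + n by ring, reflect_mul _ _ (by simp : natDegree _ ≤ 2)
      (natDegree_continuant a b n).le, reflect_C]
  rw [continuant_add_two, reflect_sub, h1, h2]
  ring

lemma coeff_zero_reflect_continuant (n : ℕ) : (reflect n (continuant a b n)).coeff 0 = 1 := by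
  simpa [coeff_reflect, revAt_le, natDegree_continuant] using
    (continuant_monic a b n).coeff_natDegree

lemma coeff_reflect_continuant_add_two (n k : ℕ) :
    (reflect (n + 2) (continuant a b (n + 2))).coeff (k + 2) =
      (reflect (n + 1) (continuant a b (n + 1))).coeff (k + 2) -
        a (n + 1) * (reflect (n + 1) (continuant a b (n + 1))).coeff (k + 1) -
        b (n + 1) * (reflect n (continuant a b n)).coeff k := by
  rw [reflect_continuant_add_two]
  simp only [coeff_sub, coeff_C_mul, coeff_X_mul]

lemma coeff_one_reflect_continuant (n : ℕ) :
    (reflect (n + 1) (continuant a b (n + 1))).coeff 1 =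
      (reflect n (continuant a b n)).coeff 1 - a n := by
  cases n with
  | zero => rw [zero_add, reflect_continuant_one]; simp [coeff_one]
  | succ n =>
    rw [reflect_continuant_add_two, coeff_sub, coeff_sub, coeff_C_mul, coeff_C_mul, coeff_X_mul,
      coeff_X_mul, coeff_X_mul_zero, coeff_zero_reflect_continuant]
    ring

lemma powerSumOne_continuant_succ (n : ℕ) :
    powerSumOne (n + 1) (continuant a b (n + 1)) = powerSumOne n (continuant a b n) + a n := by
  rw [powerSumOne, powerSumOne, coeff_one_reflect_continuant]
  ring

variable {b}

lemma powerSumTwo_continuant_succ (hb : b 0 = 0) (n : ℕ) :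
    powerSumTwo (n + 1) (continuant a b (n + 1)) =
      powerSumTwo n (continuant a b n) + (a n ^ 2 + 2 * b n) := by
  cases n with
  | zero =>
    simp only [powerSumTwo, zero_add, reflect_continuant_one]
    simp [coeff_one, hb]
  | succ n =>
    simp only [powerSumTwo, coeff_reflect_continuant_add_two a b n 0,
      coeff_one_reflect_continuant a b (n + 1),
      coeff_zero_reflect_continuant]
    ring

lemma coeff_two_reflect_continuant (hb : b 0 = 0) (n : ℕ) :
    (reflect (n + 1) (continuant a b (n + 1))).coeff 2 =
      (reflect n (continuant a b n)).coeff 2 - a n * (reflect n (continuant a b n)).coeff 1 -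
        b n := by
  cases n with
  | zero => rw [zero_add, reflect_continuant_one]; simp [coeff_one, hb]
  | succ n => rw [coeff_reflect_continuant_add_two a b n 0, coeff_zero_reflect_continuant, mul_one]

lemma powerSumFour_continuant_succ (hb : b 0 = 0) (n : ℕ) :
    powerSumFour (n + 1) (continuant a b (n + 1)) =
      powerSumFour n (continuant a b n) +
        (a n ^ 4 + 4 * b n * (a n ^ 2 + a n * a (n - 1) + a (n - 1) ^ 2) + 2 * b n ^ 2 +
          4 * b n * b (n - 1)) := by
  cases n with
  | zero =>
    simp only [powerSumFour, zero_add, reflect_continuant_one]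
    simp [coeff_one, hb]
    ring
  | succ n =>
    have h1 := coeff_one_reflect_continuant a b n
    have h2 := coeff_two_reflect_continuant a hb n
    have e1 : (reflect n (continuant a b n)).coeff 1 =
        (reflect (n + 1) (continuant a b (n + 1))).coeff 1 + a n := by linarith
    have e2 : (reflect n (continuant a b n)).coeff 2 =
        (reflect (n + 1) (continuant a b (n + 1))).coeff 2 + a n *
          ((reflect (n + 1) (continuant a b (n + 1))).coeff 1 + a n) + b n := by
      rw [← e1]; linarith
    simp only [powerSumFour, coeff_reflect_continuant_add_two a b n 1,
      coeff_reflect_continuant_add_two a b n 2,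
      coeff_two_reflect_continuant a hb (n + 1), coeff_one_reflect_continuant a b (n + 1),
      Nat.reduceAdd, e1, e2, add_tsub_cancel_right]
    ring

lemma powerSumOne_continuant (n : ℕ) :
    powerSumOne n (continuant a b n) = ∑ i ∈ Finset.range n, a i := by
  induction n with
  | zero => simp [powerSumOne, coeff_one]
  | succ n ih => rw [powerSumOne_continuant_succ, ih, Finset.sum_range_succ]

lemma powerSumTwo_continuant (hb : b 0 = 0) (n : ℕ) :
    powerSumTwo n (continuant a b n) = ∑ i ∈ Finset.range n, (a i ^ 2 + 2 * b i) := by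
  induction n with
  | zero => simp [powerSumTwo, coeff_one]
  | succ n ih => rw [powerSumTwo_continuant_succ a hb, ih, Finset.sum_range_succ]

lemma powerSumFour_continuant (hb : b 0 = 0) (n : ℕ) :
    powerSumFour n (continuant a b n) = ∑ i ∈ Finset.range n,
      (a i ^ 4 + 4 * b i * (a i ^ 2 + a i * a (i - 1) + a (i - 1) ^ 2) + 2 * b i ^ 2 +
        4 * b i * b (i - 1)) := by
  induction n with
  | zero => simp [powerSumFour, coeff_one]
  | succ n ih => rw [powerSumFour_continuant_succ a hb, ih, Finset.sum_range_succ]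

end PowerSum

/-! ### The Van Vleck zeros as roots of a continuant -/

/-- The factor `μ = x (x - 1 + τ)` for which the Lamé equation can have a solution of
degree `x`. -/
def lameEigen (τ x : ℝ) : ℝ := x * (x - 1 + τ)

/-- Diagonal entries of the tridiagonal matrix of the spectral problem of order `k`. -/
def lameDiag (s η τ : ℝ) (k : ℕ) (x : ℝ) : ℝ := (s * x * (x - 1) + η * x) / lameEigen τ k

/-- Products of opposite off-diagonal entries of the tridiagonal matrix of the spectral problem
of order `k`. -/
def lameOff (c σ τ : ℝ) (k : ℕ) (x : ℝ) : ℝ :=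
  (lameEigen τ k - lameEigen τ (x - 1)) * (c * x * (x - 1 + σ)) / lameEigen τ k ^ 2

/-- The characteristic polynomials of the leading blocks of the tridiagonal matrix of the spectral
problem of order `k`. -/
def lameContinuant (s c τ σ η : ℝ) (k : ℕ) : ℕ → ℝ[X] :=
  continuant (fun i => lameDiag s η τ k i) (fun i => lameOff c σ τ k i)

/-- The Lamé equation in a coordinate whose origin is the middle root of the leading coefficient,
so that the leading coefficient is `X³ - s X² - c X` with `c > 0`. -/
def IsLameSolution (s c τ σ η μ l : ℝ) (φ : ℝ[X]) : Prop :=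
  (X ^ 3 - C s * X ^ 2 - C c * X) * derivative (derivative φ) +
    (C τ * X ^ 2 - C η * X - C (σ * c)) * derivative φ = C μ * (X - C l) * φ

section Recurrence

variable {s c τ σ η μ l : ℝ}

lemma coeff_X_mul_derivative (φ : ℝ[X]) (n : ℕ) :
    (X * derivative φ).coeff n = n * φ.coeff n := by
  cases n with
  | zero => simp
  | succ n => rw [coeff_X_mul, coeff_derivative]; push_cast; ring

lemma coeff_X_mul_derivative_derivative (φ : ℝ[X]) (n : ℕ) :
    (X * derivative (derivative φ)).coeff n = n * (n + 1) * φ.coeff (n + 1) := by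
  rw [coeff_X_mul_derivative, coeff_derivative]; ring

lemma coeff_X_sq_mul_derivative_derivative (φ : ℝ[X]) (n : ℕ) :
    (X * (X * derivative (derivative φ))).coeff n = n * (n - 1) * φ.coeff n := by
  cases n with
  | zero => simp
  | succ n => rw [coeff_X_mul, coeff_X_mul_derivative_derivative]; push_cast; ring

/-- Because the origin is a root of the leading coefficient, the Lamé equation is a three-term
recurrence for the coefficients of `φ`. -/
lemma isLameSolution_iff (φ : ℝ[X]) : IsLameSolution s c τ σ η μ l φ ↔
    c * σ * φ.coeff 1 = μ * l * φ.coeff 0 ∧ ∀ n : ℕ,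
      c * (n + 2) * (n + 1 + σ) * φ.coeff (n + 2) =
        (μ * l - (s * (n + 1) * n + η * (n + 1))) * φ.coeff (n + 1) -
          (μ - lameEigen τ n) * φ.coeff n := by
  have h : (X ^ 3 - C s * X ^ 2 - C c * X) * derivative (derivative φ) +
      (C τ * X ^ 2 - C η * X - C (σ * c)) * derivative φ - C μ * (X - C l) * φ =
      X * (X * (X * derivative (derivative φ))) - C s * (X * (X * derivative (derivative φ))) -
        C c * (X * derivative (derivative φ)) + C τ * (X * (X * derivative φ)) -
        C η * (X * derivative φ) - C (σ * c) * derivative φ - C μ * (X * φ) +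
        C (μ * l) * φ := by
    rw [C_mul (a := μ)]
    ring
  rw [IsLameSolution, ← sub_eq_zero, h, Polynomial.ext_iff]
  simp only [coeff_sub, coeff_add, coeff_C_mul, coeff_zero]
  constructor
  · intro H
    refine ⟨?_, fun n => ?_⟩
    · have := H 0
      simp only [coeff_X_mul_zero, coeff_derivative] at this
      push_cast at this
      linear_combination -this
    · have := H (n + 1)
      simp only [coeff_X_mul, coeff_X_mul_derivative,
        coeff_X_sq_mul_derivative_derivative, coeff_derivative] at this
      push_cast at this
      rw [lameEigen]
      linear_combination -this
  · rintro ⟨H0, H⟩ n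
    cases n with
    | zero =>
      simp only [coeff_X_mul_zero, coeff_derivative]
      push_cast
      linear_combination -H0
    | succ n =>
      have := H n
      rw [lameEigen] at this
      simp only [coeff_X_mul, coeff_X_mul_derivative,
        coeff_X_sq_mul_derivative_derivative, coeff_derivative]
      push_cast
      linear_combination -this

/-- The normalizing factors between the coefficients of a solution of the Lamé equation and the
values of the continuants. -/
def lameScale (c σ τ : ℝ) (k n : ℕ) : ℝ :=
  ∏ i ∈ Finset.range n, (c * (i + 1) * (i + σ) / lameEigen τ k)

variable {k : ℕ}

lemma lameEigen_pos (hτ : 0 < τ) (hk : 1 ≤ k) : 0 < lameEigen τ k := by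
  have : (1 : ℝ) ≤ k := by exact_mod_cast hk
  exact mul_pos (by linarith) (by linarith)

lemma lameEigen_lt (hτ : 0 < τ) {i : ℕ} (h : i < k) : lameEigen τ i < lameEigen τ k := by
  have h1 : (i : ℝ) + 1 ≤ k := by exact_mod_cast h
  have h0 : (0 : ℝ) ≤ i := i.cast_nonneg
  unfold lameEigen
  nlinarith [mul_nonneg h0 (by linarith : (0 : ℝ) ≤ k - i)]

lemma lameScale_pos (hc : 0 < c) (hσ : 0 < σ) (hτ : 0 < τ) (hk : 1 ≤ k) (n : ℕ) :
    0 < lameScale c σ τ k n := by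
  have := lameEigen_pos hτ hk
  exact Finset.prod_pos fun i _ => by positivity

lemma lameOff_pos (hc : 0 < c) (hσ : 0 < σ) (hτ : 0 < τ) {i : ℕ} (h1 : 1 ≤ i) (hi : i ≤ k) :
    0 < lameOff c σ τ k i := by
  obtain ⟨i, rfl⟩ : ∃ j, i = j + 1 := ⟨i - 1, by omega⟩
  have h2 := lameEigen_pos hτ (h1.trans hi)
  have h3 := lameEigen_lt hτ (show i < k from hi)
  rw [lameOff]
  push_cast
  rw [add_sub_cancel_right]
  have := sub_pos.2 h3
  positivity

lemma lameOff_zero : lameOff c σ τ k 0 = 0 := by simp [lameOff]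

/-- Solutions of the coefficient recurrence are the rescaled values of the continuants. -/
lemma lameScale_mul_eq_iff (hc : 0 < c) (hσ : 0 < σ) (hτ : 0 < τ) (hk : 1 ≤ k) (u : ℕ → ℝ) :
    (c * σ * u 1 = lameEigen τ k * l * u 0 ∧ ∀ n : ℕ,
      c * (n + 2) * (n + 1 + σ) * u (n + 2) =
        (lameEigen τ k * l - (s * (n + 1) * n + η * (n + 1))) * u (n + 1) -
          (lameEigen τ k - lameEigen τ n) * u n) ↔
    ∀ n, lameScale c σ τ k n * u n = (lameContinuant s c τ σ η k n).eval l * u 0 := by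
  have hm := (lameEigen_pos hτ hk).ne'
  have hG := fun n => (lameScale_pos hc hσ hτ hk n).ne'
  have hs : ∀ n, lameScale c σ τ k (n + 1) =
      lameScale c σ τ k n * (c * (n + 1) * (n + σ) / lameEigen τ k) := fun n => by
    rw [lameScale, Finset.prod_range_succ, lameScale]
  have hs0 : lameScale c σ τ k 0 = 1 := by simp [lameScale]
  have hs1 : lameScale c σ τ k 1 = c * σ / lameEigen τ k := by
    rw [hs 0, hs0]; simp
  have hs2 : ∀ n : ℕ, lameScale c σ τ k (n + 2) =
      lameScale c σ τ k (n + 1) * (c * (n + 2) * (n + 1 + σ) / lameEigen τ k) := fun n => by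
    rw [hs (n + 1)]; push_cast; ring
  have hq : ∀ n, (lameContinuant s c τ σ η k (n + 2)).eval l =
      (l - (s * (n + 1) * n + η * (n + 1)) / lameEigen τ k) *
        (lameContinuant s c τ σ η k (n + 1)).eval l -
      (lameEigen τ k - lameEigen τ n) * (c * (n + 1) * (n + σ)) / lameEigen τ k ^ 2 *
        (lameContinuant s c τ σ η k n).eval l := fun n => by
    rw [lameContinuant, continuant_add_two]
    simp [lameDiag, lameOff]
  have hq0 : (lameContinuant s c τ σ η k 0).eval l = 1 := by simp [lameContinuant]
  have hq1 : (lameContinuant s c τ σ η k 1).eval l = l := by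
    simp [lameContinuant, lameDiag]
  constructor
  · rintro ⟨h0, h⟩ n
    induction n using Nat.strong_induction_on with
    | _ n ih =>
      match n with
      | 0 => rw [hs0, hq0]
      | 1 =>
        rw [hs1, hq1]
        field_simp
        linear_combination h0
      | n + 2 =>
        have i0 := ih n (by omega)
        have i1 := ih (n + 1) (by omega)
        rw [hq, sub_mul, mul_assoc, mul_assoc (_ / _), ← i0, ← i1, hs2, hs n]
        have hn := h n
        field_simp
        linear_combination (lameScale c σ τ k n) * hn
  · intro h
    refine ⟨?_, fun n => ?_⟩
    · have := h 1
      rw [hs1, hq1] at this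
      field_simp at this
      linear_combination this
    · have h0 := h n
      have h1 := h (n + 1)
      have h2 := h (n + 2)
      rw [hq, sub_mul, mul_assoc (_ - _), mul_assoc (_ / _), ← h0, ← h1, hs2, hs n] at h2
      have hne : c * ((n : ℝ) + 1) * (n + σ) ≠ 0 := by positivity
      have hG' := hG n
      refine mul_left_cancel₀ hne ?_
      field_simp at h2 ⊢
      linear_combination h2

/-- The equation has a solution of degree exactly `k ≥ 1` for some `μ` if and only if `l` is a root
of the characteristic polynomial of the tridiagonal matrix of order `k`. -/
lemma exists_isLameSolution_iff (hc : 0 < c) (hσ : 0 < σ) (hτ : 0 < τ) (hk : 1 ≤ k) :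
    (∃ (μ : ℝ) (φ : ℝ[X]), φ.degree = (k : WithBot ℕ) ∧ IsLameSolution s c τ σ η μ l φ) ↔
      (lameContinuant s c τ σ η k (k + 1)).eval l = 0 := by
  have hG := fun n => (lameScale_pos hc hσ hτ hk n).ne'
  constructor
  · rintro ⟨μ, φ, hd, h⟩
    rw [isLameSolution_iff] at h
    have hφ : φ ≠ 0 := fun h0 => by simp [h0] at hd
    have hnd : φ.natDegree = k := natDegree_eq_of_degree_eq_some hd
    have hk0 : φ.coeff k ≠ 0 := by rw [← hnd]; exact leadingCoeff_ne_zero.2 hφ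
    have hgt : ∀ n, k < n → φ.coeff n = 0 := fun n hn =>
      coeff_eq_zero_of_natDegree_lt (by rw [hnd]; exact hn)
    -- The coefficient of degree `k + 1` determines `μ`.
    have hμ : μ = lameEigen τ k := by
      have := h.2 k
      rw [hgt (k + 1) (by omega), hgt (k + 2) (by omega)] at this
      have := (mul_eq_zero.1 (by linarith : (μ - lameEigen τ k) * φ.coeff k = 0)).resolve_right hk0
      linarith
    rw [hμ, lameScale_mul_eq_iff hc hσ hτ hk] at h
    have h0 : φ.coeff 0 ≠ 0 := fun h0 => by
      have := h k
      rw [h0, mul_zero] at this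
      exact mul_ne_zero (hG k) hk0 this
    have := h (k + 1)
    rw [hgt (k + 1) (by omega), mul_zero] at this
    exact (mul_eq_zero.1 this.symm).resolve_right h0
  · intro h
    have hk0 : (lameContinuant s c τ σ η k k).eval l ≠ 0 := by
      intro h0
      have := continuant_wronskian_pos (a := fun i => lameDiag s η τ k i)
        (b := fun i => lameOff c σ τ k i) (n := k) (fun i h1 h2 => lameOff_pos hc hσ hτ h1 h2) l
      rw [lameContinuant] at h h0
      rw [h, h0] at this
      simp at this
    -- The off-diagonal entry with index `k + 1` is zero, so all later continuants vanish at `l`.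
    have hgt : ∀ n, (lameContinuant s c τ σ η k (k + 1 + n)).eval l = 0 := by
      intro n
      induction n using Nat.strong_induction_on with
      | _ n ih =>
        match n with
        | 0 => exact h
        | 1 =>
          rw [lameContinuant, show k + 1 + 1 = k + 2 from rfl, continuant_add_two]
          rw [lameContinuant] at h
          have hz : lameOff c σ τ k ((k + 1 : ℕ) : ℝ) = 0 := by simp [lameOff]
          simp only [eval_sub, eval_mul, eval_C, h, hz, mul_zero, zero_mul, sub_zero]
        | n + 2 =>
          have h0 := ih n (by omega)
          have h1 := ih (n + 1) (by omega)
          rw [lameContinuant] at h0 h1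
          rw [← add_assoc] at h1
          rw [lameContinuant, ← add_assoc, continuant_add_two]
          simp [h0, h1]
    obtain ⟨u, hu⟩ : ∃ u : ℕ → ℝ, ∀ n, u n =
      (lameContinuant s c τ σ η k n).eval l / lameScale c σ τ k n := ⟨_, fun _ => rfl⟩
    have hu0 : ∀ n, k < n → u n = 0 := fun n hn => by
      obtain ⟨j, rfl⟩ : ∃ j, n = k + 1 + j := ⟨n - (k + 1), by omega⟩
      rw [hu, hgt, zero_div]
    obtain ⟨φ, hφ⟩ : ∃ φ : ℝ[X], ∀ n, φ.coeff n = u n := by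
      refine ⟨∑ i ∈ Finset.range (k + 1), C (u i) * X ^ i, fun n => ?_⟩
      simp only [finsetSum_coeff, coeff_C_mul_X_pow, Finset.sum_ite_eq, Finset.mem_range]
      split_ifs with hn
      · rfl
      · exact (hu0 n (by omega)).symm
    refine ⟨lameEigen τ k, φ, ?_, ?_⟩
    · refine le_antisymm ((degree_le_iff_coeff_zero _ _).2 fun n hn => ?_)
        (le_degree_of_ne_zero ?_)
      · rw [hφ, hu0 n (by exact_mod_cast hn)]
      · rw [hφ, hu]
        exact div_ne_zero hk0 (hG k)
    · rw [isLameSolution_iff, lameScale_mul_eq_iff hc hσ hτ hk]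
      intro n
      have h0 : φ.coeff 0 = 1 := by simp [hφ, hu, lameContinuant, lameScale]
      rw [h0, hφ, hu, mul_one, mul_div_cancel₀ _ (hG n)]

end Recurrence

/-! ### The spectral polynomials as shifted continuants -/

section Spectral

variable {α ρ : Fin 3 → ℝ} {ν₀ : ℝ}

/-- The shifted equation has `s = u + w`, `c = -u w`, where `u < 0 < w` are the roots of the
leading coefficient other than the origin. -/
lemma isLameSolution_taylor_iff (μ ν : ℝ) (φ : ℝ[X]) :
    coeffA α * derivative (derivative φ) + coeffB α ρ * derivative φ =
      C μ * (X - C ν) * φ ↔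
    IsLameSolution ((α 0 - α 1) + (α 2 - α 1)) (-((α 0 - α 1) * (α 2 - α 1)))
      (2 * (ρ 0 + ρ 1 + ρ 2)) (2 * ρ 1)
      (2 * (ρ 0 * (α 2 - α 1) + ρ 1 * ((α 0 - α 1) + (α 2 - α 1)) + ρ 2 * (α 0 - α 1)))
      μ (ν - α 1) (taylor (α 1) φ) := by
  have hder : ∀ f : ℝ[X], derivative (taylor (α 1) f) = taylor (α 1) (derivative f) := by
    intro f
    simp [taylor_apply, derivative_comp]
  have hA : taylor (α 1) (coeffA α) = X ^ 3 - C ((α 0 - α 1) + (α 2 - α 1)) * X ^ 2 -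
      C (-((α 0 - α 1) * (α 2 - α 1))) * X := by
    simp only [coeffA, taylor_apply, mul_comp, Fin.prod_univ_three, sub_comp, X_comp, C_comp,
      C_sub, C_add, C_neg, C_mul]
    ring
  have hB : taylor (α 1) (coeffB α ρ) = C (2 * (ρ 0 + ρ 1 + ρ 2)) * X ^ 2 -
      C (2 * (ρ 0 * (α 2 - α 1) + ρ 1 * ((α 0 - α 1) + (α 2 - α 1)) + ρ 2 * (α 0 - α 1))) * X -
      C (2 * ρ 1 * (-((α 0 - α 1) * (α 2 - α 1)))) := by
    have e0 : (Finset.univ.erase (0 : Fin 3)) = {1, 2} := by decide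
    have e1 : (Finset.univ.erase (1 : Fin 3)) = {0, 2} := by decide
    have e2 : (Finset.univ.erase (2 : Fin 3)) = {0, 1} := by decide
    simp only [coeffB, taylor_apply, Fin.sum_univ_three, e0, e1, e2]
    rw [Finset.prod_pair (by decide), Finset.prod_pair (by decide), Finset.prod_pair (by decide)]
    simp only [add_comp, mul_comp, sub_comp, X_comp, C_comp, C_sub, C_add, C_neg, C_mul]
    ring
  have hν : taylor (α 1) (X - C ν) = X - C (ν - α 1) := by
    simp only [taylor_apply, sub_comp, X_comp, C_comp, C_sub]
    ring
  have hr : C μ * taylor (α 1) (X - C ν) * taylor (α 1) φ = taylor (α 1) (C μ * (X - C ν) * φ) := by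
    rw [taylor_mul, taylor_mul, taylor_C]
  rw [IsLameSolution, hder, hder, ← hA, ← hB, ← hν, ← taylor_mul, ← taylor_mul, ← map_add, hr,
    (taylor_injective (α 1)).eq_iff]

variable (α ρ) in
/-- The tridiagonal matrix polynomials `lameContinuant` of the equation with parameters `α`, `ρ`,
in the coordinate centred at `α 1`. -/
def shiftedContinuant : ℕ → ℕ → ℝ[X] :=
  lameContinuant ((α 0 - α 1) + (α 2 - α 1)) (-((α 0 - α 1) * (α 2 - α 1)))
    (2 * (ρ 0 + ρ 1 + ρ 2)) (2 * ρ 1)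
    (2 * (ρ 0 * (α 2 - α 1) + ρ 1 * ((α 0 - α 1) + (α 2 - α 1)) + ρ 2 * (α 0 - α 1)))

lemma vanVleckZeros_eq (hα : StrictMono α) (hρ : ∀ i, 0 < ρ i) {k : ℕ} (hk : 1 ≤ k) :
    vanVleckZeros α ρ k = {ν | (shiftedContinuant α ρ k (k + 1)).eval (ν - α 1) = 0} := by
  have h01 : α 0 < α 1 := hα (by decide)
  have h12 : α 1 < α 2 := hα (by decide)
  have h0 := hρ 0
  have h1 := hρ 1
  have h2 := hρ 2
  ext ν
  rw [Set.mem_ofPred_eq, shiftedContinuant, ← exists_isLameSolution_iff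
    (neg_pos.2 (mul_neg_of_neg_of_pos (sub_neg.2 h01) (sub_pos.2 h12)))
    (by positivity) (by positivity) hk]
  constructor
  · rintro ⟨μ, φ, hd, h⟩
    exact ⟨μ, taylor (α 1) φ, by rwa [degree_taylor], (isLameSolution_taylor_iff μ ν φ).1 h⟩
  · rintro ⟨μ, ψ, hd, h⟩
    obtain ⟨φ, rfl⟩ : ∃ φ, taylor (α 1) φ = ψ := (taylorEquiv (α 1)).surjective ψ
    exact ⟨μ, φ, by rwa [degree_taylor] at hd,
      (isLameSolution_taylor_iff μ ν φ).2 h⟩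

lemma spectralPoly_add_two (hα : StrictMono α) (hρ : ∀ i, 0 < ρ i) (k : ℕ) :
    spectralPoly α ρ ν₀ (k + 2) = (shiftedContinuant α ρ (k + 1) (k + 2)).comp (X - C (α 1)) := by
  have h01 : α 0 < α 1 := hα (by decide)
  have h12 : α 1 < α 2 := hα (by decide)
  have h0 := hρ 0
  have h1 := hρ 1
  have h2 := hρ 2
  rw [spectralPoly, vanVleckZeros_eq hα hρ (by omega), shiftedContinuant, lameContinuant]
  exact finprod_roots_continuant (fun i h1 h2 => lameOff_pos
    (neg_pos.2 (mul_neg_of_neg_of_pos (sub_neg.2 h01) (sub_pos.2 h12)))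
    (by positivity) (by positivity) h1 h2) _

lemma spectralPoly_monic_natDegree (hα : StrictMono α) (hρ : ∀ i, 0 < ρ i) (n : ℕ) :
    (spectralPoly α ρ ν₀ n).Monic ∧ (spectralPoly α ρ ν₀ n).natDegree = n := by
  match n with
  | 0 => simp [spectralPoly]
  | 1 => simp [spectralPoly, monic_X_sub_C]
  | k + 2 =>
    rw [spectralPoly_add_two hα hρ]
    refine ⟨(continuant_monic _ _ _).comp_X_sub_C _, ?_⟩
    rw [natDegree_comp, natDegree_X_sub_C, mul_one]
    exact natDegree_continuant _ _ _

/-- Translating the variable translates the diagonal of a continuant. -/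
lemma continuant_comp_X_add_C (a b : ℕ → ℝ) (r : ℝ) (n : ℕ) :
    (continuant a b n).comp (X + C r) = continuant (fun i => a i - r) b n := by
  induction n using Nat.strong_induction_on with
  | _ n ih =>
    match n with
    | 0 => simp
    | 1 => simp only [continuant_one, sub_comp, X_comp, C_comp, C_sub]; ring
    | n + 2 =>
      rw [continuant_add_two, continuant_add_two, ← ih n (by omega), ← ih (n + 1) (by omega)]
      simp only [sub_comp, mul_comp, X_comp, C_comp, C_sub]
      ring

/-- If the spectral polynomials are orthogonal, then the characteristic polynomials of all the
tridiagonal matrices of order `k ≥ 1` are continuants of one and the same pair of sequences. -/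
lemma exists_continuant_eq_shiftedContinuant (hα : StrictMono α) (hρ : ∀ i, 0 < ρ i)
    {m : Measure ℝ} (h : IsOrthogonalSeq (spectralPoly α ρ ν₀) m) :
    ∃ a b : ℕ → ℝ, b 0 = 0 ∧ ∀ k, 1 ≤ k → continuant a b (k + 1) =
      shiftedContinuant α ρ k (k + 1) := by
  obtain ⟨a, b, hb, hab⟩ := h.exists_eq_continuant
    (fun n => (spectralPoly_monic_natDegree hα hρ n).1)
    (fun n => (spectralPoly_monic_natDegree hα hρ n).2)
  refine ⟨fun i => a i - α 1, b, hb, fun k hk => ?_⟩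
  obtain ⟨k, rfl⟩ : ∃ j, k = j + 1 := ⟨k - 1, by omega⟩
  rw [← continuant_comp_X_add_C, ← hab, spectralPoly_add_two hα hρ, comp_assoc]
  simp

end Spectral

/-! ### Riemann sums of triangular arrays -/

section Profile

open Filter Topology

/-- The triangular array `f k i`, `0 ≤ i ≤ k`, is `g (i / k) + O(1 / k)`, uniformly in `i`, for the
polynomial `g`. -/
def HasProfile (f : ℕ → ℕ → ℝ) (g : ℝ[X]) : Prop :=
  ∃ K : ℝ, ∀ k i : ℕ, 1 ≤ k → i ≤ k → |f k i - g.eval ((i : ℝ) / k)| ≤ K / k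

variable {f F : ℕ → ℕ → ℝ} {g G : ℝ[X]}

lemma exists_abs_eval_div_le (g : ℝ[X]) :
    ∃ M : ℝ, 0 ≤ M ∧ ∀ k i : ℕ, 1 ≤ k → i ≤ k → |g.eval ((i : ℝ) / k)| ≤ M := by
  obtain ⟨M, hM⟩ := (isCompact_Icc (a := (0 : ℝ)) (b := 1)).exists_bound_of_continuousOn
    g.continuous.continuousOn
  have h0 := (norm_nonneg _).trans (hM 0 (by simp))
  refine ⟨M, h0, fun k i hk hi => hM _ ⟨by positivity, ?_⟩⟩
  have : (0 : ℝ) < k := by exact_mod_cast hk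
  rw [div_le_one this]
  exact_mod_cast hi

lemma hasProfile_const (x : ℝ) : HasProfile (fun _ _ => x) (C x) :=
  ⟨0, fun k i _ _ => by simp⟩

lemma HasProfile.add (hf : HasProfile f g) (hF : HasProfile F G) :
    HasProfile (fun k i => f k i + F k i) (g + G) := by
  obtain ⟨K, hK⟩ := hf
  obtain ⟨L, hL⟩ := hF
  refine ⟨K + L, fun k i hk hi => ?_⟩
  rw [eval_add, add_sub_add_comm, add_div]
  exact (abs_add_le _ _).trans (add_le_add (hK k i hk hi) (hL k i hk hi))

lemma HasProfile.mul (hf : HasProfile f g) (hF : HasProfile F G) :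
    HasProfile (fun k i => f k i * F k i) (g * G) := by
  obtain ⟨K, hK⟩ := hf
  obtain ⟨L, hL⟩ := hF
  obtain ⟨M, hM0, hM⟩ := exists_abs_eval_div_le g
  obtain ⟨N, hN0, hN⟩ := exists_abs_eval_div_le G
  have hL0 : 0 ≤ L := by simpa using (abs_nonneg _).trans (hL 1 0 le_rfl (by simp))
  have hK0 : 0 ≤ K := by simpa using (abs_nonneg _).trans (hK 1 0 le_rfl (by simp))
  refine ⟨K * (N + L) + M * L, fun k i hk hi => ?_⟩
  have hk1 : (1 : ℝ) ≤ k := by exact_mod_cast hk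
  have h1 := hK k i hk hi
  have h2 := hL k i hk hi
  have hF1 : |F k i| ≤ N + L := by
    have : L / k ≤ L := div_le_self hL0 hk1
    have h3 := abs_add_le (F k i - G.eval ((i : ℝ) / k)) (G.eval ((i : ℝ) / k))
    rw [sub_add_cancel] at h3
    linarith [hN k i hk hi]
  rw [eval_mul, show f k i * F k i - g.eval ((i : ℝ) / k) * G.eval ((i : ℝ) / k) =
    (f k i - g.eval ((i : ℝ) / k)) * F k i +
      g.eval ((i : ℝ) / k) * (F k i - G.eval ((i : ℝ) / k)) by ring]
  refine (abs_add_le _ _).trans ?_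
  rw [abs_mul, abs_mul, add_div, mul_div_right_comm, mul_div_assoc M]
  exact add_le_add (mul_le_mul h1 hF1 (abs_nonneg _) (by positivity))
    (mul_le_mul (hM k i hk hi) h2 (abs_nonneg _) hM0)

lemma HasProfile.pow (hf : HasProfile f g) (n : ℕ) :
    HasProfile (fun k i => f k i ^ n) (g ^ n) := by
  induction n with
  | zero => simpa using hasProfile_const 1
  | succ n ih => simpa only [pow_succ] using ih.mul hf

lemma HasProfile.const_mul (x : ℝ) (hf : HasProfile f g) :
    HasProfile (fun k i => x * f k i) (C x * g) :=
  (hasProfile_const x).mul hf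

lemma HasProfile.congr (hf : HasProfile f g) (h : ∀ k i, 1 ≤ k → i ≤ k → F k i = f k i)
    (hg : G = g) : HasProfile F G := by
  obtain ⟨K, hK⟩ := hf
  exact ⟨K, fun k i hk hi => by rw [h k i hk hi, hg]; exact hK k i hk hi⟩

lemma hasProfile_div : HasProfile (fun k i => (i : ℝ) / k) X := ⟨0, fun k i _ _ => by simp⟩

lemma hasProfile_pred_div : HasProfile (fun k i => ((i - 1 : ℕ) : ℝ) / k) X := by
  refine ⟨1, fun k i hk _ => ?_⟩
  have hk0 : (0 : ℝ) < k := by exact_mod_cast hk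
  rw [eval_X, ← sub_div, abs_div, abs_of_pos hk0]
  refine div_le_div_of_nonneg_right ?_ hk0.le
  cases i with
  | zero => simp
  | succ i => simp

lemma hasProfile_inv : HasProfile (fun k _ => 1 / (k : ℝ)) 0 := by
  refine ⟨1, fun k i _ _ => ?_⟩
  rw [eval_zero, sub_zero, abs_of_nonneg (by positivity)]

/-- The Riemann sums of a monomial, from the comparison of a monotone sum with an integral. -/
lemma abs_sum_pow_sub_le (n k : ℕ) :
    |(k : ℝ)⁻¹ * ∑ i ∈ Finset.range (k + 1), ((i : ℝ) / k) ^ n - 1 / (n + 1)| ≤ 1 / k ∨ k = 0 := by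
  rcases Nat.eq_zero_or_pos k with rfl | hk
  · exact Or.inr rfl
  left
  have hk0 : (0 : ℝ) < k := by exact_mod_cast hk
  have hmono : MonotoneOn (fun x : ℝ => x ^ n) (Set.Icc 0 (0 + (k : ℕ))) :=
    fun x hx y _ hxy => pow_le_pow_left₀ hx.1 hxy n
  have h1 := hmono.sum_le_integral
  have h2 := hmono.integral_le_sum
  simp only [zero_add, integral_pow] at h1 h2
  rw [zero_pow (by omega), sub_zero] at h1 h2
  have h3 : ∑ i ∈ Finset.range (k + 1), (i : ℝ) ^ n ≤ (k : ℝ) ^ (n + 1) / (n + 1) + k ^ n := by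
    rw [Finset.sum_range_succ]
    linarith
  have h4 : (k : ℝ) ^ (n + 1) / (n + 1) ≤ ∑ i ∈ Finset.range (k + 1), (i : ℝ) ^ n := by
    rw [Finset.sum_range_succ']
    exact h2.trans (le_add_of_nonneg_right (by positivity))
  have e : (k : ℝ)⁻¹ * ∑ i ∈ Finset.range (k + 1), ((i : ℝ) / k) ^ n - 1 / (n + 1) =
      (∑ i ∈ Finset.range (k + 1), (i : ℝ) ^ n - (k : ℝ) ^ (n + 1) / (n + 1)) / k ^ (n + 1) := by
    simp only [div_pow, ← Finset.sum_div]
    field_simp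
    ring
  rw [e, abs_div, abs_of_pos (pow_pos hk0 (n + 1)), abs_of_nonneg (by linarith),
    div_le_div_iff₀ (by positivity) hk0, pow_succ, one_mul]
  rw [pow_succ] at h3
  exact mul_le_mul_of_nonneg_right (by linarith) hk0.le

lemma tendsto_riemann_sum (g : ℝ[X]) :
    Tendsto (fun k : ℕ => (k : ℝ)⁻¹ * ∑ i ∈ Finset.range (k + 1), g.eval ((i : ℝ) / k)) atTop
      (𝓝 (∫ x in (0 : ℝ)..1, g.eval x)) := by
  induction g using Polynomial.induction_on' with
  | add p q hp hq =>
    simp only [eval_add, Finset.sum_add_distrib, mul_add]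
    rw [intervalIntegral.integral_add (p.continuous.intervalIntegrable _ _)
      (q.continuous.intervalIntegrable _ _)]
    exact hp.add hq
  | monomial n a =>
    simp only [eval_monomial, ← Finset.mul_sum, mul_left_comm _ a]
    rw [intervalIntegral.integral_const_mul, integral_pow]
    refine Tendsto.const_mul a ?_
    rw [one_pow, zero_pow (by omega), sub_zero, tendsto_iff_dist_tendsto_zero]
    refine squeeze_zero' (Eventually.of_forall fun _ => dist_nonneg) ?_
      (tendsto_const_div_atTop_nhds_zero_nat 1)
    filter_upwards [eventually_ne_atTop 0] with k hk
    exact (abs_sum_pow_sub_le n k).resolve_right hk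

lemma HasProfile.tendsto_sum (hf : HasProfile f g) :
    Tendsto (fun k : ℕ => (k : ℝ)⁻¹ * ∑ i ∈ Finset.range (k + 1), f k i) atTop
      (𝓝 (∫ x in (0 : ℝ)..1, g.eval x)) := by
  obtain ⟨K, hK⟩ := hf
  have hK0 : 0 ≤ K := by simpa using (abs_nonneg _).trans (hK 1 0 le_rfl (by simp))
  have h := (tendsto_riemann_sum g)
  have hd : Tendsto (fun k : ℕ => (k : ℝ)⁻¹ * ∑ i ∈ Finset.range (k + 1), f k i -
      (k : ℝ)⁻¹ * ∑ i ∈ Finset.range (k + 1), g.eval ((i : ℝ) / k)) atTop (𝓝 0) := by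
    refine squeeze_zero_norm' ?_ (tendsto_const_div_atTop_nhds_zero_nat (2 * K))
    filter_upwards [eventually_ge_atTop 1] with k hk
    have hk1 : (1 : ℝ) ≤ k := by exact_mod_cast hk
    have hk0 : (0 : ℝ) < k := by linarith
    rw [← mul_sub, ← Finset.sum_sub_distrib, Real.norm_eq_abs, abs_mul, abs_of_pos (by positivity)]
    have hs : |∑ i ∈ Finset.range (k + 1), (f k i - g.eval ((i : ℝ) / k))| ≤ (k + 1) * (K / k) := by
      refine (Finset.abs_sum_le_sum_abs _ _).trans ?_
      refine (Finset.sum_le_card_nsmul _ _ (K / k) fun i hi =>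
        hK k i hk (by simpa [Nat.lt_succ_iff] using hi)).trans ?_
      simp
    have : (k + 1) * (K / k) ≤ 2 * K := by
      rw [← mul_div_assoc, div_le_iff₀ hk0]
      nlinarith
    rw [div_eq_inv_mul]
    exact mul_le_mul_of_nonneg_left (hs.trans this) (by positivity)
  simpa using hd.add h

end Profile

/-! ### Limits of the power sums of the roots -/

section Limits

open Filter Topology

lemma sum_range_quartic (w₁ w₂ w₃ w₄ : ℝ) (k : ℕ) :
    ∑ i ∈ Finset.range (k + 1), (w₄ * (i : ℝ) ^ 4 + w₃ * (i : ℝ) ^ 3 + w₂ * (i : ℝ) ^ 2 + w₁ * i) =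
      w₄ * (k ^ 5 / 5 + k ^ 4 / 2 + k ^ 3 / 3 - k / 30) +
        w₃ * (k ^ 4 / 4 + k ^ 3 / 2 + k ^ 2 / 4) + w₂ * (k ^ 3 / 3 + k ^ 2 / 2 + k / 6) +
        w₁ * (k ^ 2 / 2 + k / 2) := by
  induction k with
  | zero => simp
  | succ k ih => rw [Finset.sum_range_succ, ih]; push_cast; ring

/-- A rational function of `k` that grows linearly has convergent differences. -/
lemma tendsto_sub_of_quintic_div {θ A₁ A₂ A₃ A₄ A₅ : ℝ} {f : ℕ → ℝ} (hθ : -1 < θ)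
    (hf : ∀ k : ℕ, 1 ≤ k → f k = (A₅ * k ^ 5 + A₄ * k ^ 4 + A₃ * k ^ 3 + A₂ * k ^ 2 + A₁ * k) /
      (k * (k + θ)) ^ 2) :
    Tendsto (fun k => f (k + 1) - f k) atTop (𝓝 A₅) := by
  have hz : Tendsto (fun k : ℕ => 1 / (k : ℝ)) atTop (𝓝 0) :=
    tendsto_const_div_atTop_nhds_zero_nat 1
  have hlim : Tendsto (fun k : ℕ => f k - A₅ * k) atTop (𝓝 (A₄ - 2 * A₅ * θ)) := by
    have hc : ContinuousAt (fun z : ℝ => ((A₄ - 2 * A₅ * θ) + (A₃ - A₅ * θ ^ 2) * z + A₂ * z ^ 2 +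
        A₁ * z ^ 3) / (1 + θ * z) ^ 2) 0 := by
      refine ContinuousAt.div (by fun_prop) (by fun_prop) (by simp)
    have := hc.tendsto.comp hz
    simp only [mul_zero, add_zero, ne_eq, OfNat.ofNat_ne_zero, not_false_eq_true, zero_pow, one_pow,
      div_one] at this
    refine this.congr' ?_
    filter_upwards [eventually_ge_atTop 1] with k hk
    have hk1 : (1 : ℝ) ≤ k := by exact_mod_cast hk
    have h0 : (k : ℝ) ≠ 0 := by linarith
    have h1 : (k : ℝ) + θ ≠ 0 := by linarith
    have h2 : 1 + θ * (1 / (k : ℝ)) = (k + θ) / k := by field_simp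
    rw [hf k hk, Function.comp, h2]
    field_simp
    ring
  have h1 := (hlim.comp (tendsto_add_atTop_nat 1)).sub hlim
  rw [sub_self] at h1
  have h2 := h1.add_const A₅
  rw [zero_add] at h2
  refine h2.congr fun k => ?_
  simp only [Function.comp]
  push_cast
  ring

lemma tendsto_sub_of_sum_div {τ w₁ w₂ w₃ w₄ h₁ h₂ : ℝ} {f : ℕ → ℝ} (hτ : 0 < τ)
    (hf : ∀ k : ℕ, 1 ≤ k → f k = (∑ i ∈ Finset.range (k + 1),
      (w₄ * (i : ℝ) ^ 4 + w₃ * (i : ℝ) ^ 3 + w₂ * (i : ℝ) ^ 2 + w₁ * i +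
        lameEigen τ k * (h₂ * (i : ℝ) ^ 2 + h₁ * i))) / lameEigen τ k ^ 2) :
    Tendsto (fun k => f (k + 1) - f k) atTop (𝓝 (w₄ / 5 + h₂ / 3)) := by
  refine tendsto_sub_of_quintic_div (θ := τ - 1) (A₁ := -w₄ / 30 + w₂ / 6 + w₁ / 2)
    (A₂ := w₃ / 4 + w₂ / 2 + w₁ / 2 + (τ - 1) * (h₂ / 6 + h₁ / 2))
    (A₃ := w₄ / 3 + w₃ / 2 + w₂ / 3 + h₂ / 6 + h₁ / 2 + (τ - 1) * (h₂ / 2 + h₁ / 2))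
    (A₄ := w₄ / 2 + w₃ / 4 + h₂ / 2 + h₁ / 2 + (τ - 1) * h₂ / 3) (by linarith) fun k hk => ?_
  have h := sum_range_quartic h₁ h₂ 0 0 k
  simp only [zero_mul, zero_add] at h
  rw [hf k hk, Finset.sum_add_distrib, ← Finset.mul_sum, h, sum_range_quartic, lameEigen]
  congr 1 <;> ring

end Limits

section Final

open Filter Topology

variable {s c τ σ η : ℝ}

lemma hasProfile_sq_div_lameEigen (hτ : 0 < τ) :
    HasProfile (fun k _ => (k : ℝ) ^ 2 / lameEigen τ k) 1 := by
  refine ⟨|1 - τ| / min 1 τ, fun k i hk _ => ?_⟩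
  have hk1 : (1 : ℝ) ≤ k := by exact_mod_cast hk
  have hk0 : (0 : ℝ) < k := by linarith
  have hd : 0 < (k : ℝ) - 1 + τ := by linarith
  have hm : 0 < min 1 τ := lt_min one_pos hτ
  have hmk : min 1 τ * k ≤ (k : ℝ) - 1 + τ := by
    nlinarith [min_le_left 1 τ, min_le_right 1 τ]
  have e : (k : ℝ) ^ 2 / lameEigen τ k - 1 = (1 - τ) / ((k : ℝ) - 1 + τ) := by
    rw [lameEigen]
    field_simp
    ring
  rw [eval_one, e, abs_div, abs_of_pos hd, div_div]
  exact div_le_div_of_nonneg_left (abs_nonneg _) (by positivity) hmk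

variable {x : ℕ → ℕ → ℝ}

/-- Along any index array `x k i` with `x k i / k ≈ i / k`, the diagonal entries have profile
`s X²`. -/
lemma hasProfile_lameDiag (hτ : 0 < τ) (hx : HasProfile (fun k i => x k i / k) X) :
    HasProfile (fun k i => lameDiag s η τ k (x k i)) (C s * X ^ 2) := by
  refine ((((hx.const_mul s).mul (hx.add (hasProfile_inv.const_mul (-1)))).add
    ((hx.const_mul η).mul hasProfile_inv)).mul (hasProfile_sq_div_lameEigen hτ)).congr ?_ (by ring)
  intro k i hk _
  have h := (lameEigen_pos hτ hk).ne'
  have hk0 : (k : ℝ) ≠ 0 := by positivity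
  rw [lameDiag]
  field_simp
  ring

/-- Along any index array `x k i` with `x k i / k ≈ i / k`, the off-diagonal products have profile
`c X² (1 - X²)`. -/
lemma hasProfile_lameOff (hτ : 0 < τ) (hx : HasProfile (fun k i => x k i / k) X) :
    HasProfile (fun k i => lameOff c σ τ k (x k i)) (C c * X ^ 2 * (1 - X ^ 2)) := by
  have hm := hasProfile_sq_div_lameEigen hτ
  have h1 := (((hx.add (hasProfile_inv.const_mul (-1))).mul
    (hx.add (hasProfile_inv.const_mul (τ - 2)))).mul hm).const_mul (-1)
  refine ((((hasProfile_const 1).add h1).mul ((hx.const_mul c).mul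
    (hx.add (hasProfile_inv.const_mul (σ - 1))))).mul hm).congr ?_ (by simp; ring)
  intro k i hk _
  have h := (lameEigen_pos hτ hk).ne'
  have hk0 : (k : ℝ) ≠ 0 := by positivity
  rw [lameOff]
  field_simp
  rw [show lameEigen τ (x k i - 1) = (x k i - 1) * (x k i - 2 + τ) by rw [lameEigen]; ring]
  ring

/-- The limit of the normalized sums of fourth powers of the Van Vleck zeros. -/
lemma tendsto_powerSumFour_lameContinuant (hτ : 0 < τ) :
    Tendsto (fun k : ℕ => (k : ℝ)⁻¹ * powerSumFour (k + 1) (lameContinuant s c τ σ η k (k + 1)))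
      atTop (𝓝 (s ^ 4 / 9 + 24 / 63 * s ^ 2 * c + 48 / 315 * c ^ 2)) := by
  have d := hasProfile_lameDiag (s := s) (η := η) hτ hasProfile_div
  have d' := hasProfile_lameDiag (s := s) (η := η) hτ hasProfile_pred_div
  have o := hasProfile_lameOff (c := c) (σ := σ) hτ hasProfile_div
  have o' := hasProfile_lameOff (c := c) (σ := σ) hτ hasProfile_pred_div
  have h := ((((d.pow 4).add ((o.const_mul 4).mul (((d.pow 2).add (d.mul d')).add (d'.pow 2)))).add
    ((o.pow 2).const_mul 2)).add ((o.const_mul 4).mul o')).tendsto_sum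
  have hI : ∫ t in (0 : ℝ)..1, (s ^ 4 * t ^ 8 + 12 * s ^ 2 * c * (t ^ 6 - t ^ 8) +
      6 * c ^ 2 * (t ^ 4 - 2 * t ^ 6 + t ^ 8)) =
      s ^ 4 / 9 + 24 / 63 * s ^ 2 * c + 48 / 315 * c ^ 2 := by
    have hc : ∀ n : ℕ, IntervalIntegrable (fun t : ℝ => t ^ n) volume 0 1 := fun n =>
      (continuous_pow n).intervalIntegrable _ _
    have : ∀ t : ℝ, s ^ 4 * t ^ 8 + 12 * s ^ 2 * c * (t ^ 6 - t ^ 8) +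
        6 * c ^ 2 * (t ^ 4 - 2 * t ^ 6 + t ^ 8) =
        (s ^ 4 - 12 * s ^ 2 * c + 6 * c ^ 2) * t ^ 8 + (12 * s ^ 2 * c - 12 * c ^ 2) * t ^ 6 +
          6 * c ^ 2 * t ^ 4 := fun t => by ring
    simp only [this]
    rw [intervalIntegral.integral_add (((hc 8).const_mul _).add ((hc 6).const_mul _))
      ((hc 4).const_mul _), intervalIntegral.integral_add ((hc 8).const_mul _)
      ((hc 6).const_mul _)]
    simp only [intervalIntegral.integral_const_mul, integral_pow]
    norm_num
    ring
  rw [← hI]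
  convert h using 3 with k
  · rw [lameContinuant, powerSumFour_continuant _ (by simpa using lameOff_zero)]
  · funext t
    simp only [eval_add, eval_sub, eval_mul, eval_pow, eval_C, eval_X, eval_one]
    ring

lemma tendsto_powerSumOne_lameContinuant_sub (hτ : 0 < τ) :
    Tendsto (fun k : ℕ => powerSumOne (k + 2) (lameContinuant s c τ σ η (k + 1) (k + 2)) -
      powerSumOne (k + 1) (lameContinuant s c τ σ η k (k + 1))) atTop (𝓝 (s / 3)) := by
  have := tendsto_sub_of_sum_div (τ := τ) (w₁ := 0) (w₂ := 0) (w₃ := 0) (w₄ := 0) (h₁ := η - s)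
    (h₂ := s) (f := fun k => powerSumOne (k + 1) (lameContinuant s c τ σ η k (k + 1))) hτ
    (fun k hk => ?_)
  · simpa using this
  · have h := (lameEigen_pos hτ hk).ne'
    simp only [lameContinuant, powerSumOne_continuant]
    rw [Finset.sum_div]
    refine Finset.sum_congr rfl fun i _ => ?_
    rw [lameDiag]
    field_simp
    ring

lemma tendsto_powerSumTwo_lameContinuant_sub (hτ : 0 < τ) :
    Tendsto (fun k : ℕ => powerSumTwo (k + 2) (lameContinuant s c τ σ η (k + 1) (k + 2)) -
      powerSumTwo (k + 1) (lameContinuant s c τ σ η k (k + 1))) atTop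
      (𝓝 (s ^ 2 / 5 + 4 / 15 * c)) := by
  have := tendsto_sub_of_sum_div (τ := τ) (w₁ := 2 * c * (τ - 2) * (σ - 1))
    (w₂ := (η - s) ^ 2 - 2 * c * ((τ - 3) * (σ - 1) + 2 - τ))
    (w₃ := 2 * s * (η - s) - 2 * c * (σ + τ - 4)) (w₄ := s ^ 2 - 2 * c) (h₁ := 2 * c * (σ - 1))
    (h₂ := 2 * c) (f := fun k => powerSumTwo (k + 1) (lameContinuant s c τ σ η k (k + 1))) hτ
    (fun k hk => ?_)
  · convert this using 2
    ring
  · have h := (lameEigen_pos hτ hk).ne'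
    simp only [lameContinuant]
    rw [powerSumTwo_continuant _ (by simpa using lameOff_zero), Finset.sum_div]
    refine Finset.sum_congr rfl fun i _ => ?_
    rw [lameDiag, lameOff]
    field_simp
    rw [show lameEigen τ (i - 1 : ℝ) = (i - 1) * (i - 2 + τ) by rw [lameEigen]; ring]
    ring

/-- The characteristic polynomials of the tridiagonal matrices of the Lamé equation do not come
from a single three-term recurrence: the first two power sums of the roots would determine the
limits of the recurrence coefficients, and these limits give too small a mean fourth power. -/
lemma not_forall_continuant_eq_lameContinuant (hτ : 0 < τ) (hc : 0 < c) {a b : ℕ → ℝ}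
    (hb : b 0 = 0)
    (h : ∀ k, 1 ≤ k → continuant a b (k + 1) = lameContinuant s c τ σ η k (k + 1)) : False := by
  have ha : Tendsto a atTop (𝓝 (s / 3)) := by
    rw [← tendsto_add_atTop_iff_nat 1]
    refine (tendsto_powerSumOne_lameContinuant_sub (s := s) (c := c) (σ := σ) (η := η) hτ).congr' ?_
    filter_upwards [eventually_ge_atTop 1] with k hk
    rw [← h k hk, ← h (k + 1) (by omega), powerSumOne_continuant_succ, add_sub_cancel_left]
  have hab : Tendsto (fun n => a n ^ 2 + 2 * b n) atTop (𝓝 (s ^ 2 / 5 + 4 / 15 * c)) := by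
    rw [← tendsto_add_atTop_iff_nat 1]
    refine (tendsto_powerSumTwo_lameContinuant_sub (s := s) (c := c) (σ := σ) (η := η) hτ).congr' ?_
    filter_upwards [eventually_ge_atTop 1] with k hk
    rw [← h k hk, ← h (k + 1) (by omega), powerSumTwo_continuant_succ a hb, add_sub_cancel_left]
  have hb' : Tendsto b atTop (𝓝 ((2 * s ^ 2 + 6 * c) / 45)) := by
    have := (hab.sub (ha.pow 2)).div_const 2
    convert this using 2 with n <;> ring
  have hpred : Tendsto (fun n : ℕ => n - 1) atTop atTop := tendsto_sub_atTop_nat 1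
  have ha' := ha.comp hpred
  have hb'' := hb'.comp hpred
  have hu := (((ha.pow 4).add ((hb'.const_mul 4).mul (((ha.pow 2).add (ha.mul ha')).add
    (ha'.pow 2)))).add ((hb'.pow 2).const_mul 2)).add ((hb'.const_mul 4).mul hb'')
  -- The factor `1 + 1 / k` turns the normalization by `k + 1` of the Cesàro mean into one by `k`.
  have h1 := (hu.cesaro.comp (tendsto_add_atTop_nat 1)).mul
    (tendsto_const_nhds.add (tendsto_const_div_atTop_nhds_zero_nat (1 : ℝ)) :
      Tendsto (fun k : ℕ => 1 + 1 / (k : ℝ)) atTop (𝓝 (1 + 0)))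
  have h2 := tendsto_powerSumFour_lameContinuant (s := s) (c := c) (σ := σ) (η := η) hτ
  -- The two limits of the mean fourth power differ by a form with positive coefficients.
  have heq := tendsto_nhds_unique h2 (h1.congr' ?_)
  · nlinarith [mul_nonneg (sq_nonneg s) hc.le, sq_nonneg (s ^ 2), mul_pos hc hc]
  · filter_upwards [eventually_ge_atTop 1] with k hk
    have hk0 : (k : ℝ) ≠ 0 := by positivity
    rw [← h k hk, powerSumFour_continuant a hb]
    simp only [Function.comp]
    generalize (∑ i ∈ Finset.range (k + 1), _ : ℝ) = S
    push_cast
    field_simp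

end Final

end Lame

end

theorem theorem3p1 (α ρ : Fin 3 → ℝ) (hα : StrictMono α) (hρ : ∀ i, 0 < ρ i) (ν₀ : ℝ) :
    ¬ ∃ m : MeasureTheory.Measure ℝ,
      Lame.IsOrthogonalSeq (Lame.spectralPoly α ρ ν₀) m := by
  rintro ⟨m, hm⟩
  have h01 : α 0 < α 1 := hα (by decide)
  have h12 : α 1 < α 2 := hα (by decide)
  have h0 := hρ 0
  have h1 := hρ 1
  have h2 := hρ 2
  obtain ⟨a, b, hb, h⟩ := Lame.exists_continuant_eq_shiftedContinuant hα hρ hm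
  exact Lame.not_forall_continuant_eq_lameContinuant (by positivity)
    (neg_pos.2 (mul_neg_of_neg_of_pos (sub_neg.2 h01) (sub_pos.2 h12))) hb h
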